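/- Let $R$ be a commutative ring with unit. For $f \in R[x]$ let $c(f)$ denote the ideal of $R$ generated by the coefficients of $f$; the ring $R$ is called Gaussian if $c(f)c(g) = c(fg)$ for all $f, g \in R[x]$. The weak dimension $\operatorname{w.gl.dim}_R(M)$ of an $R$-module $M$ is the least integer $n \ge 0$ such that there is an exact sequence $0 \to F_n \to \cdots \to F_1 \to F_0 \to M \to 0$ with all $F_i$ flat $R$-modules, and $\infty$ if there is no such $n$; the weak global dimension of $R$ is $\operatorname{w.gl.dim}(R) = \sup\{\operatorname{w.gl.dim}_R(M) \mid M \text{ an } R\text{-module}\}$. Theorem. Let $R$ be a non-reduced local (not necessarily Noetherian) Gaussian ring with nilradical $\mathcal{N}$, and let $D = \{x \in R \mid x^2 = 0\}$. If $\mathcal{N} \neq D$, then $\operatorname{w.gl.dim}(R) = \infty$. -/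

import Mathlib

universe u

namespace BazzoniGlaz

/-- A polynomial `f` over a commutative ring is Gaussian if `c(f) c(g) = c(f g)` for every
polynomial `g`, where `c` denotes the ideal generated by the coefficients. -/
def IsGaussianPolynomial {R : Type u} [CommRing R] (f : Polynomial R) : Prop :=
  ∀ g : Polynomial R, f.contentIdeal * g.contentIdeal = (f * g).contentIdeal

/-- A commutative ring is Gaussian if every polynomial over it is Gaussian. -/
def IsGaussianRing (R : Type u) [CommRing R] : Prop :=
  ∀ f : Polynomial R, IsGaussianPolynomial f

/-- There is a resolution `0 → F n → ⋯ → F 1 → F 0 → M → 0` of `M` by flat `R`-modules.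
The resolution is indexed by all natural numbers, with `F i = 0` for `i > n`. -/
def HasFlatResolutionOfLength (R : Type u) [CommRing R] (M : Type u) [AddCommGroup M]
    [Module R M] (n : ℕ) : Prop :=
  ∃ (F : ℕ → ModuleCat.{u} R) (d : ∀ i : ℕ, F (i + 1) →ₗ[R] F i) (ε : F 0 →ₗ[R] M),
    (∀ i, Module.Flat R (F i)) ∧
    (∀ i, n < i → Subsingleton (F i)) ∧
    Function.Surjective ε ∧
    Function.Exact (d 0) ε ∧
    ∀ i, Function.Exact (d (i + 1)) (d i)

/-- The weak (flat) dimension of a module: the least length of a flat resolution, and `⊤` if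
there is no finite flat resolution. -/
noncomputable def moduleWeakDim (R : Type u) [CommRing R] (M : Type u) [AddCommGroup M]
    [Module R M] : ℕ∞ :=
  ⨅ (n : ℕ) (_ : HasFlatResolutionOfLength R M n), (n : ℕ∞)

/-- The weak global dimension of a ring: the supremum of the weak dimensions of its modules. -/
noncomputable def weakGlobalDim (R : Type u) [CommRing R] : ℕ∞ :=
  ⨆ M : ModuleCat.{u} R, moduleWeakDim R M

end BazzoniGlaz

/-! Suppose the dimension is finite. A local Gaussian ring is almost a chain ring
(`IsGaussianRing.isAlmostChain`), so `x * y = 0` forces `x ^ 2 = 0` or `y ^ 2 = 0`, and the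
nilradical 𝒩 is prime. Localizing at 𝒩 keeps this property and the dimension bound, and makes the
maximal ideal m nil.

There, dimension shifting (`IsTorsionBounded.of_exact`) shows that Tor₁(R/b, Z), for b outside the
socle, is killed by a power of m depending only on the flat dimension of Z. Testing cyclic modules
makes m nilpotent. If m ≠ 0, it contains a socle element s ≠ 0, and finite flat dimension collapses
to flatness (`HasFlatDimLE.flat_of_pow_eq_bot`); but R/s is not flat. So m = 0: each element of 𝒩 is
killed by a non-nilpotent one, hence has square zero, and 𝒩 = D. -/

namespace BazzoniGlaz

/-- Any two elements are comparable for divisibility up to an error term of square zero that is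
annihilated by the divisor. -/
def IsAlmostChain (R : Type u) [CommRing R] : Prop :=
  ∀ a b : R, (∃ s c, b = s * a + c ∧ c * a = 0 ∧ c ^ 2 = 0) ∨
    (∃ s c, a = s * b + c ∧ c * b = 0 ∧ c ^ 2 = 0)

/-! ### Local Gaussian rings are almost chain rings -/

section Gaussian

variable {R : Type u} [CommRing R]

open Polynomial in
-- The content formula for (aX + b)(uX + v), the only case needed.
theorem IsGaussianRing.mul_mem_span (h : IsGaussianRing R) (a b u v p q : R)
    (hp : p = a ∨ p = b) (hq : q = u ∨ q = v) :
    p * q ∈ Ideal.span {a * u, a * v + b * u, b * v} := by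
  have hf : p ∈ (C a * X + C b : R[X]).contentIdeal := by
    rcases hp with rfl | rfl
    · have := coeff_mem_contentIdeal (C p * X + C b : R[X]) 1
      rwa [show (C p * X + C b : R[X]).coeff 1 = p by simp [coeff_C]] at this
    · have := coeff_mem_contentIdeal (C a * X + C p : R[X]) 0
      rwa [show (C a * X + C p : R[X]).coeff 0 = p by simp [coeff_C]] at this
  have hg : q ∈ (C u * X + C v : R[X]).contentIdeal := by
    rcases hq with rfl | rfl
    · have := coeff_mem_contentIdeal (C q * X + C v : R[X]) 1
      rwa [show (C q * X + C v : R[X]).coeff 1 = q by simp [coeff_C]] at this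
    · have := coeff_mem_contentIdeal (C u * X + C q : R[X]) 0
      rwa [show (C u * X + C q : R[X]).coeff 0 = q by simp [coeff_C]] at this
  have hpq := h _ _ ▸ Ideal.mul_mem_mul hf hg
  have hfg : (C a * X + C b) * (C u * X + C v) =
      C (a * u) * X ^ 2 + C (a * v + b * u) * X + C (b * v) := by
    simp only [map_add, map_mul]; ring
  rw [hfg, contentIdeal_def] at hpq
  generalize a * u = α, a * v + b * u = β, b * v = γ at hpq ⊢
  refine Ideal.span_le.mpr ?_ hpq
  intro x hx
  obtain ⟨n, -, rfl⟩ := mem_coeffs_iff.mp (Finset.mem_coe.mp hx)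
  match n with
  | 0 => simpa using Ideal.subset_span (by simp)
  | 1 => simpa [coeff_X, coeff_C, coeff_X_pow] using Ideal.subset_span (by simp)
  | 2 => simpa [coeff_X, coeff_C, coeff_X_pow] using Ideal.subset_span (by simp)
  | n + 3 => simp

variable [IsLocalRing R]

theorem IsGaussianRing.sq_dvd_or_sq_dvd (h : IsGaussianRing R) (a b : R) :
    (a ^ 2 ∣ b ^ 2 ∧ a ^ 2 ∣ a * b) ∨ (b ^ 2 ∣ a ^ 2 ∧ b ^ 2 ∣ a * b) := by
  have key : ∀ a b r s : R, a * b = r * a ^ 2 + s * b ^ 2 → IsUnit s →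
      a ^ 2 ∣ b ^ 2 ∧ a ^ 2 ∣ a * b := by
    rintro a b r _ hab ⟨s, rfl⟩
    -- With t = s⁻¹, all coefficients of (aX + b)(aX + (ta - b)) are multiples of a².
    obtain ⟨t, ht⟩ : ∃ t : R, t * s = 1 := ⟨(s⁻¹ : Rˣ), by simp⟩
    have hle : Ideal.span {a * a, a * (t * a - b) + b * a, b * (t * a - b)} ≤
        Ideal.span {a ^ 2} := by
      simp only [Ideal.span_le, Set.insert_subset_iff, Set.singleton_subset_iff, SetLike.mem_coe,
        Ideal.mem_span_singleton]
      exact ⟨⟨1, by ring⟩, ⟨t, by ring⟩, ⟨t * r, by linear_combination t * hab + b ^ 2 * ht⟩⟩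
    have h1 := Ideal.mem_span_singleton.mp (hle (h.mul_mem_span a b a (t * a - b) a (t * a - b)
      (.inl rfl) (.inr rfl)))
    have h2 := Ideal.mem_span_singleton.mp (hle (h.mul_mem_span a b a (t * a - b) b a
      (.inr rfl) (.inl rfl)))
    have h3 := Ideal.mem_span_singleton.mp (hle (h.mul_mem_span a b a (t * a - b) b (t * a - b)
      (.inr rfl) (.inr rfl)))
    refine ⟨?_, by rwa [mul_comm]⟩
    have := dvd_sub (h2.mul_left t) h3
    convert this using 1
    ring
  obtain ⟨r, s, hrs⟩ : ∃ r s, a * b = r * a ^ 2 + s * b ^ 2 := by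
    obtain ⟨x, y, z, hxyz⟩ := Submodule.mem_span_triple.mp
      (h.mul_mem_span a b a (-b) a (-b) (.inl rfl) (.inr rfl))
    refine ⟨-x, z, ?_⟩
    simp only [smul_eq_mul] at hxyz
    linear_combination hxyz
  by_cases hs : IsUnit s
  · exact .inl (key a b r s hrs hs)
  by_cases hr : IsUnit r
  · have := key b a s r (by linear_combination hrs) hr
    exact .inr ⟨this.1, by simpa [mul_comm] using this.2⟩
  -- Now r, s lie in m. The product (aX + b)(bX - a) relates a² to b², and one of the two
  -- coefficients is a unit, according to whether y is.
  obtain ⟨x, y, z, hxyz⟩ := Submodule.mem_span_triple.mp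
      (h.mul_mem_span a b b (-a) a (-a) (.inl rfl) (.inr rfl))
  simp only [smul_eq_mul] at hxyz
  set p := z - x with hp
  have e : (1 - y - p * r) * a ^ 2 = (p * s - y) * b ^ 2 := by
    linear_combination hxyz + p * hrs
  have hmr : p * r ∈ nonunits R := fun hu => hr (isUnit_of_mul_isUnit_right hu)
  have hms : p * s ∈ nonunits R := fun hu => hs (isUnit_of_mul_isUnit_right hu)
  by_cases hy : IsUnit y
  · have hu : IsUnit (p * s - y) := by
      by_contra hn
      have := IsLocalRing.nonunits_add (a := p * s) (b := -(p * s - y)) hms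
        (by simpa only [mem_nonunits_iff, IsUnit.neg_iff] using hn)
      rw [neg_sub, add_sub_cancel] at this
      exact this hy
    obtain ⟨w, hw⟩ := hu.dvd (a := (1 : R))
    have hb : a ^ 2 ∣ b ^ 2 := ⟨w * (1 - y - p * r), by linear_combination -w * e + b ^ 2 * hw⟩
    refine .inl ⟨hb, hrs ▸ dvd_add ⟨r, by ring⟩ (hb.mul_left s)⟩
  · have hu : IsUnit (1 - y - p * r) := by
      by_contra hn
      have h1 := IsLocalRing.nonunits_add (a := p * r) (b := y) hmr hy
      have := IsLocalRing.nonunits_add h1 hn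
      exact this (by ring_nf; exact isUnit_one)
    obtain ⟨w, hw⟩ := hu.dvd (a := (1 : R))
    have hb : b ^ 2 ∣ a ^ 2 := ⟨w * (p * s - y), by linear_combination w * e + a ^ 2 * hw⟩
    refine .inr ⟨hb, hrs ▸ dvd_add (hb.mul_left r) ⟨s, by ring⟩⟩

theorem IsGaussianRing.isAlmostChain (h : IsGaussianRing R) : IsAlmostChain R := by
  have key : ∀ a b : R, a ^ 2 ∣ b ^ 2 → a ^ 2 ∣ a * b →
      ∃ s c, b = s * a + c ∧ c * a = 0 ∧ c ^ 2 = 0 := by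
    rintro a b ⟨v, hv⟩ ⟨t, ht⟩
    have hca : (b - t * a) * a = 0 := by linear_combination ht
    refine ⟨t, b - t * a, by ring, hca, ?_⟩
    have hc2 : (b - t * a) ^ 2 = (v - t ^ 2) * a ^ 2 := by linear_combination hv - 2 * t * ht
    -- For c = b - ta, the product (aX + c)(cX - (v - t²)a) is zero, so c · c = 0.
    have hm := h.mul_mem_span a (b - t * a) (b - t * a) (-(v - t ^ 2) * a) (b - t * a) (b - t * a)
      (.inr rfl) (.inl rfl)
    have h0 : Ideal.span {a * (b - t * a), a * (-(v - t ^ 2) * a) + (b - t * a) * (b - t * a),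
        (b - t * a) * (-(v - t ^ 2) * a)} = ⊥ := by
      rw [Ideal.span_eq_bot]
      simp only [Set.mem_insert_iff, Set.mem_singleton_iff]
      rintro x (rfl | rfl | rfl)
      · linear_combination hca
      · linear_combination hc2
      · linear_combination -(v - t ^ 2) * hca
    rw [h0] at hm
    simpa [sq] using hm
  intro a b
  rcases h.sq_dvd_or_sq_dvd a b with ⟨h1, h2⟩ | ⟨h1, h2⟩
  · exact .inl (key a b h1 h2)
  · exact .inr (key b a h1 (by rwa [mul_comm]))

end Gaussian

/-! ### Divisibility in almost chain rings -/

section AlmostChain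

variable {R : Type u} [CommRing R]

theorem sq_mul_eq_zero {a : R} (t : R) (ha : a ^ 2 = 0) : (t * a) ^ 2 = 0 := by
  linear_combination t ^ 2 * ha

theorem IsAlmostChain.mul_eq_zero_of_sq (h : IsAlmostChain R) {a b : R} (ha : a ^ 2 = 0)
    (hb : b ^ 2 = 0) : a * b = 0 := by
  rcases h a b with ⟨s, c, hs, hc, -⟩ | ⟨s, c, hs, hc, -⟩
  · linear_combination a * hs + s * ha + hc
  · linear_combination b * hs + s * hb + hc

theorem IsAlmostChain.sq_add (h : IsAlmostChain R) {a b : R} (ha : a ^ 2 = 0)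
    (hb : b ^ 2 = 0) : (a + b) ^ 2 = 0 := by
  linear_combination ha + hb + 2 * h.mul_eq_zero_of_sq ha hb

theorem IsAlmostChain.sq_sub (h : IsAlmostChain R) {a b : R} (ha : a ^ 2 = 0)
    (hb : b ^ 2 = 0) : (a - b) ^ 2 = 0 := by
  linear_combination ha + hb - 2 * h.mul_eq_zero_of_sq ha hb

theorem IsAlmostChain.sq_eq_zero_or (h : IsAlmostChain R) {x y : R} (hxy : x * y = 0) :
    x ^ 2 = 0 ∨ y ^ 2 = 0 := by
  rcases h x y with ⟨s, c, hs, hc, hc2⟩ | ⟨s, c, hs, hc, hc2⟩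
  · right; linear_combination (y + c) * hs + s * hxy + s * hc + hc2
  · left; linear_combination (x + c) * hs + s * hxy + s * hc + hc2

/-- Comparison of an element of nonzero square with one of square zero. -/
theorem IsAlmostChain.exists_eq_of_sq (h : IsAlmostChain R) {a b : R} (ha : a ^ 2 = 0)
    (hb : b ^ 2 ≠ 0) : ∃ s c, a = s * b + c ∧ c * b = 0 ∧ c ^ 2 = 0 := by
  rcases h a b with ⟨s, c, rfl, -, hc⟩ | H
  · exact absurd (h.sq_add (sq_mul_eq_zero s ha) hc) hb
  · exact H

/-- One step of the reduction behind `IsAlmostChain.mul_mem_span_mul`. -/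
theorem IsAlmostChain.exists_mul_eq (h : IsAlmostChain R) {b c : R} (hb : b ^ 2 ≠ 0)
    (hc : c ^ 2 = 0) (hcb : c * b = 0) (a : R) :
    ∃ u e, c * a = u * (b * a) + e * a ^ 2 ∧ e ^ 2 = 0 ∧ e * b = 0 := by
  rcases h b a with ⟨t, d, had, -, hd⟩ | ⟨t, d, hbd, hda, hd⟩
  · exact ⟨0, 0, by linear_combination c * had + t * hcb + h.mul_eq_zero_of_sq hc hd,
      by simp, by simp⟩
  have hcta : c * (t * a) = 0 := by
    linear_combination hcb - c * hbd - h.mul_eq_zero_of_sq hc hd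
  rcases h c a with ⟨s, f, haf, -, hf⟩ | ⟨s, f, hcf, hfa, hf⟩
  · refine ⟨0, 0, ?_, by simp, by simp⟩
    linear_combination c * haf + s * hc + h.mul_eq_zero_of_sq hc hf
  have hsa : (s * a) ^ 2 = 0 := by
    rw [show s * a = c - f by linear_combination -hcf]
    exact h.sq_sub hc hf
  rcases h s t with ⟨u, e, hte, -, he⟩ | ⟨u, e, hse, het, he⟩
  · refine absurd ?_ hb
    rw [show b = u * (s * a) + (a * e + d) by linear_combination hbd + a * hte]
    exact h.sq_add (sq_mul_eq_zero u hsa) (h.sq_add (sq_mul_eq_zero a he) hd)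
  · refine ⟨u, e, ?_, he, ?_⟩
    · linear_combination a * hcf + a ^ 2 * hse - u * a * hbd + hfa - u * hda
    · linear_combination e * hbd + a * het + h.mul_eq_zero_of_sq he hd

/-- Modulo (ba), `exists_mul_eq` replaces ca by ea² with e subject to the same hypotheses as c;
iterating reaches a vanishing power of a. -/
theorem IsAlmostChain.mul_dvd_mul_of_mul_eq_zero (h : IsAlmostChain R) {a b c : R}
    (ha : IsNilpotent a) (hb : b ^ 2 ≠ 0) (hc : c ^ 2 = 0) (hcb : c * b = 0) :
    b * a ∣ c * a := by
  obtain ⟨n, hn⟩ := ha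
  suffices ∀ i j, j + i = n → ∀ c : R, c ^ 2 = 0 → c * b = 0 → b * a ∣ c * a ^ (j + 1) by
    simpa using this n 0 (by simp) c hc hcb
  intro i
  induction i with
  | zero => rintro j rfl c - -; simp [pow_succ, show a ^ j = 0 from hn]
  | succ i ih =>
    intro j hj c hc hcb
    obtain ⟨u, e, hue, he, heb⟩ := h.exists_mul_eq hb hc hcb a
    have := ih (j + 1) (by omega) e he heb
    rw [show c * a ^ (j + 1) = (b * a) * (u * a ^ j) + e * a ^ (j + 1 + 1) by
      linear_combination a ^ j * hue]
    exact dvd_add (Dvd.intro _ rfl) this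

theorem IsAlmostChain.dvd_mul_or_dvd_mul_of_sq_ne_zero (h : IsAlmostChain R) {a r s : R}
    (ha : IsNilpotent a) (hs : s ^ 2 ≠ 0) : s * a ∣ r * a ∨ r * a ∣ s * a := by
  rcases h r s with ⟨u, c, hsc, hcr, hc⟩ | ⟨u, c, hrc, hcs, hc⟩
  · have hr : r ^ 2 ≠ 0 := fun hr => hs (hsc ▸ h.sq_add (sq_mul_eq_zero u hr) hc)
    right
    rw [hsc, add_mul, mul_assoc]
    exact dvd_add (Dvd.intro_left _ rfl) (h.mul_dvd_mul_of_mul_eq_zero ha hr hc hcr)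
  · left
    rw [hrc, add_mul, mul_assoc]
    exact dvd_add (Dvd.intro_left _ rfl) (h.mul_dvd_mul_of_mul_eq_zero ha hs hc hcs)

/-- Nilpotent principal ideals are uniserial modules. -/
theorem IsAlmostChain.mul_dvd_mul_total (h : IsAlmostChain R) {a : R} (ha : IsNilpotent a)
    (r s : R) : s * a ∣ r * a ∨ r * a ∣ s * a := by
  obtain ⟨n, hn⟩ := id ha
  suffices ∀ i j, j + i = n → ∀ r s : R,
      s * a ^ (j + 1) ∣ r * a ^ (j + 1) ∨ r * a ^ (j + 1) ∣ s * a ^ (j + 1) by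
    simpa using this n 0 (by simp) r s
  intro i
  induction i with
  | zero => rintro j rfl r s; simp [pow_succ, show a ^ j = 0 from hn]
  | succ i ih =>
    intro j hj r s
    have lift : (s * a ∣ r * a ∨ r * a ∣ s * a) →
        s * a ^ (j + 1) ∣ r * a ^ (j + 1) ∨ r * a ^ (j + 1) ∣ s * a ^ (j + 1) := by
      simp only [pow_succ', ← mul_assoc]
      exact Or.imp (mul_dvd_mul_right · _) (mul_dvd_mul_right · _)
    by_cases hs : s ^ 2 = 0
    · by_cases hr : r ^ 2 = 0
      · by_cases ha2 : a ^ 2 = 0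
        · exact lift (by simp [h.mul_eq_zero_of_sq hr ha2])
        -- Here ra = pa² and sa = qa², which passes to the next power of a.
        · obtain ⟨p, r', hr', hra, -⟩ := h.exists_eq_of_sq hr ha2
          obtain ⟨q, s', hs', hsa, -⟩ := h.exists_eq_of_sq hs ha2
          rw [show r * a ^ (j + 1) = p * a ^ (j + 1 + 1) by
              linear_combination a ^ (j + 1) * hr' + a ^ j * hra,
            show s * a ^ (j + 1) = q * a ^ (j + 1 + 1) by
              linear_combination a ^ (j + 1) * hs' + a ^ j * hsa]
          exact ih (j + 1) (by omega) p q
      · exact lift (h.dvd_mul_or_dvd_mul_of_sq_ne_zero ha hr).symm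
    · exact lift (h.dvd_mul_or_dvd_mul_of_sq_ne_zero ha hs)

theorem IsAlmostChain.dvd_mul_of_sq_eq_zero (h : IsAlmostChain R) {a b y : R}
    (ha : IsNilpotent a) (hb : b ^ 2 ≠ 0) (hy : y ^ 2 = 0) : b ∣ y * a := by
  obtain ⟨s, c, rfl, hcb, hc⟩ := h.exists_eq_of_sq hy hb
  rw [add_mul]
  exact dvd_add ⟨s * a, by ring⟩
    ((Dvd.intro _ rfl).trans (h.mul_dvd_mul_of_mul_eq_zero ha hb hc hcb))

/-- If `b * c` is not annihilated by every nilpotent element, then the annihilator of `c` is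
contained in `(b)`, up to multiplication by nilpotent elements. -/
theorem IsAlmostChain.dvd_mul_of_mul_eq_zero (h : IsAlmostChain R) {a₀ a b c y : R}
    (ha₀ : IsNilpotent a₀) (ha : IsNilpotent a) (habc : a₀ * (b * c) ≠ 0) (hyc : y * c = 0) :
    b ∣ y * a := by
  have hbc : b * c ≠ 0 := fun h0 => habc (by simp [h0])
  by_cases hb : b ^ 2 = 0
  · have hy : y ^ 2 = 0 :=
      (h.sq_eq_zero_or hyc).resolve_right fun hc => hbc (h.mul_eq_zero_of_sq hb hc)
    have key : ∀ a : R, IsNilpotent a → a * (b * c) ≠ 0 → b ∣ y * a := by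
      intro a ha habc
      rcases h.mul_dvd_mul_total ha y b with H | ⟨k, hk⟩
      · exact (Dvd.intro _ rfl).trans H
      · exact absurd (by linear_combination c * hk + a * k * hyc) habc
    -- Either abc ≠ 0 as well, or ya is a multiple of ya₀.
    rcases h a a₀ with ⟨s, g, hs, -, hg⟩ | ⟨s, g, hs, -, hg⟩
    · refine key a ha fun h0 => habc ?_
      linear_combination b * c * hs + s * h0 + c * h.mul_eq_zero_of_sq hg hb
    · rw [show y * a = s * (y * a₀) by
        linear_combination y * hs + h.mul_eq_zero_of_sq hy hg]
      exact (key a₀ ha₀ habc).mul_left s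
  · by_cases hy : y ^ 2 = 0
    · exact h.dvd_mul_of_sq_eq_zero ha hb hy
    have hc := (h.sq_eq_zero_or hyc).resolve_left hy
    rcases h b y with ⟨s, e, hs, -, he⟩ | ⟨s, e, hs, -, he⟩
    · rw [hs, add_mul]
      exact dvd_add ⟨s * a, by ring⟩ (h.dvd_mul_of_sq_eq_zero ha hb he)
    · exact absurd (by linear_combination c * hs + s * hyc + h.mul_eq_zero_of_sq he hc) hbc

end AlmostChain

end BazzoniGlaz

/-! ### Flat dimension by short exact sequences -/

namespace BazzoniGlaz

open TensorProduct

/-- `M` has a flat resolution of length at most `n`, presented as successive short exact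
sequences. -/
def HasFlatDimLE (R : Type u) [CommRing R] :
    ℕ → ∀ (M : Type u) [AddCommGroup M] [Module R M], Prop
  | 0, M, _, _ => Module.Flat R M
  | n + 1, M, _, _ => ∃ (Z F : ModuleCat.{u} R) (i : Z →ₗ[R] F) (p : F →ₗ[R] M),
      Function.Injective i ∧ Function.Exact i p ∧ Function.Surjective p ∧
      Module.Flat R F ∧ HasFlatDimLE R n Z

section

variable {R : Type u} [CommRing R]

theorem HasFlatDimLE.of_linearEquiv {n : ℕ} {M N : Type u} [AddCommGroup M] [Module R M]
    [AddCommGroup N] [Module R N] (e : M ≃ₗ[R] N) (h : HasFlatDimLE R n M) :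
    HasFlatDimLE R n N := by
  match n, h with
  | 0, h =>
    have : Module.Flat R M := h
    exact Module.Flat.of_linearEquiv e.symm
  | n + 1, ⟨Z, F, i, p, hi, hip, hp, hF, hZ⟩ =>
    refine ⟨Z, F, i, e ∘ₗ p, hi, ?_, e.surjective.comp hp, hF, hZ⟩
    intro x
    simpa using hip x

theorem HasFlatDimLE.baseChange (S : Type u) [CommRing S] [Algebra R S] [Module.Flat R S] {n : ℕ}
    {M : Type u} [AddCommGroup M] [Module R M] (h : HasFlatDimLE R n M) :
    HasFlatDimLE S n (S ⊗[R] M) := by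
  induction n generalizing M with
  | zero => exact @Module.Flat.baseChange R S M _ _ _ _ _ h
  | succ n ih =>
    obtain ⟨Z, F, i, p, hi, hip, hp, hF, hZ⟩ := h
    refine ⟨.of S (S ⊗[R] Z), .of S (S ⊗[R] F), i.baseChange S, p.baseChange S, ?_, ?_, ?_, ?_,
      ih hZ⟩
    · exact Module.Flat.lTensor_preserves_injective_linearMap i hi
    · exact Module.Flat.lTensor_exact S hip
    · exact LinearMap.lTensor_surjective S hp
    · exact @Module.Flat.baseChange R S F _ _ _ _ _ hF

theorem HasFlatResolutionOfLength.hasFlatDimLE {M : Type u} [AddCommGroup M] [Module R M] {n : ℕ}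
    (h : HasFlatResolutionOfLength R M n) : HasFlatDimLE R n M := by
  induction n generalizing M with
  | zero =>
    obtain ⟨F, d, ε, hF, hsub, hε, h0, -⟩ := h
    have hinj : Function.Injective ε := by
      rw [injective_iff_map_eq_zero]
      intro x hx
      obtain ⟨y, rfl⟩ := (h0 x).mp hx
      have := hsub 1 zero_lt_one
      rw [Subsingleton.elim y 0, map_zero]
    have := hF 0
    exact Module.Flat.of_linearEquiv (LinearEquiv.ofBijective ε ⟨hinj, hε⟩).symm
  | succ n ih =>
    obtain ⟨F, d, ε, hF, hsub, hε, h0, hd⟩ := h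
    refine ⟨.of R (LinearMap.ker ε), F 0, (LinearMap.ker ε).subtype, ε,
      Subtype.val_injective, ?_, hε, hF 0, ih ?_⟩
    · intro x; simp
    refine ⟨fun i => F (i + 1), fun i => d (i + 1),
      (d 0).codRestrict (LinearMap.ker ε) fun x => (h0 _).mpr ⟨x, rfl⟩,
      fun i => hF _, fun i hi => hsub _ (by omega), ?_, ?_, fun i => hd (i + 1)⟩
    · rintro ⟨x, hx⟩
      obtain ⟨y, hy⟩ := (h0 x).mp hx
      exact ⟨y, Subtype.ext hy⟩
    · intro x
      rw [← hd 0 x]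
      exact Subtype.ext_iff

theorem exists_forall_hasFlatDimLE (h : weakGlobalDim R ≠ ⊤) :
    ∃ N : ℕ, ∀ (M : Type u) [AddCommGroup M] [Module R M], ∃ n ≤ N, HasFlatDimLE R n M := by
  obtain ⟨N, hN⟩ := ENat.ne_top_iff_exists.mp h
  refine ⟨N, fun M _ _ => ?_⟩
  -- A strict bound on the infimum yields a witness.
  have hM : moduleWeakDim R M < ((N + 1 : ℕ) : ℕ∞) := by
    refine lt_of_le_of_lt ((le_iSup (fun M : ModuleCat.{u} R => moduleWeakDim R M)
      (ModuleCat.of R M)).trans hN.ge) ?_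
    exact_mod_cast Nat.lt_succ_self N
  simp only [moduleWeakDim, iInf_lt_iff] at hM
  obtain ⟨n, hn, hlt⟩ := hM
  exact ⟨n, by have : n < N + 1 := by exact_mod_cast hlt
               omega, hn.hasFlatDimLE⟩

/-- Tor₁(R/b, F) = 0 in terms of elements, from the equational criterion for bf = 0. -/
theorem _root_.Module.Flat.mem_annihilator_smul_top {F : Type u} [AddCommGroup F] [Module R F]
    [Module.Flat R F] {b : R} {f : F} (h : b • f = 0) :
    f ∈ (Ideal.span {b}).annihilator • (⊤ : Submodule R F) := by
  obtain ⟨k, a, y, hx, ha⟩ := Module.Flat.isTrivialRelation_of_sum_smul_eq_zero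
    (f := fun _ : Unit => b) (x := fun _ => f) (by simpa using h)
  rw [show f = _ from hx ()]
  refine sum_mem fun j _ => Submodule.smul_mem_smul ?_ trivial
  rw [Submodule.mem_annihilator_span_singleton]
  simpa [mul_comm] using ha j

end

end BazzoniGlaz

/-! ### Torsion bounds and nilpotency of a nil maximal ideal -/

namespace BazzoniGlaz

/-- Comparing a with b makes ab a multiple of a² or b², so I² ⊆ D; and D² = 0. -/
theorem IsAlmostChain.pow_four_eq_bot {R : Type u} [CommRing R]
    (h : IsAlmostChain R) {I : Ideal R}
    (hI : ∀ b ∈ I, (b ^ 2) ^ 2 = 0) : I ^ 4 = ⊥ := by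
  let D : Ideal R :=
    { carrier := {x | x ^ 2 = 0}
      add_mem' := fun ha hb => h.sq_add ha hb
      zero_mem' := by simp
      smul_mem' := fun t _ ha => sq_mul_eq_zero t ha }
  have hID : I ^ 2 ≤ D := by
    rw [sq, Ideal.mul_le]
    intro a ha b hb
    rcases h a b with ⟨s, c, hs, hc, -⟩ | ⟨s, c, hs, hc, -⟩
    · rw [show a * b = s * a ^ 2 by linear_combination a * hs + hc]
      exact D.mul_mem_left _ (hI a ha)
    · rw [show a * b = s * b ^ 2 by linear_combination b * hs + hc]
      exact D.mul_mem_left _ (hI b hb)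
  rw [show 4 = 2 * 2 from rfl, pow_mul, sq (I ^ 2), eq_bot_iff, Ideal.mul_le]
  exact fun a ha b hb => h.mul_eq_zero_of_sq (hID ha) (hID hb)

theorem smul_mk_span_singleton_one {R : Type u} [CommRing R] (b : R) :
    b • (Ideal.Quotient.mk (Ideal.span {b}) 1) = 0 := by
    rw [← Ideal.Quotient.mk_eq_mk, ← Submodule.Quotient.mk_smul, Submodule.Quotient.mk_eq_zero]
    simp

theorem exists_eq_add_of_smul_mk_one_mem {R : Type u} [CommRing R] {b μ : R}
    (hmem : μ • (Ideal.Quotient.mk (Ideal.span {b}) 1) ∈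
      (Ideal.span {b}).annihilator • (⊤ : Submodule R (R ⧸ Ideal.span {b}))) :
    ∃ r u, μ = r + u * b ∧ r * b = 0 := by
  obtain ⟨r, hr, hrμ⟩ : ∃ r, r * b = 0 ∧ Ideal.Quotient.mk (Ideal.span {b}) r =
      μ • Ideal.Quotient.mk (Ideal.span {b}) 1 := by
    refine Submodule.smul_induction_on (p := fun t => ∃ r, r * b = 0 ∧
      Ideal.Quotient.mk (Ideal.span {b}) r = t) hmem ?_ ?_
    · rintro r hr n -
      rw [Submodule.mem_annihilator_span_singleton, smul_eq_mul] at hr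
      obtain ⟨n, rfl⟩ := Ideal.Quotient.mk_surjective n
      exact ⟨r * n, by linear_combination n * hr, by rw [map_mul]; rfl⟩
    · rintro _ _ ⟨r, hr, rfl⟩ ⟨s, hs, rfl⟩
      exact ⟨r + s, by linear_combination hr + hs, map_add _ _ _⟩
  have hsub : Ideal.Quotient.mk (Ideal.span {b}) (μ - r) = 0 := by
    rw [map_sub, hrμ, sub_eq_zero]
    change _ = Ideal.Quotient.mk (Ideal.span {b}) (μ * 1)
    rw [mul_one]
  obtain ⟨u, hu⟩ := Ideal.mem_span_singleton'.mp (Ideal.Quotient.eq_zero_iff_mem.mp hsub)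
  exact ⟨r, u, by linear_combination -hu, hr⟩

section NonNilpotent

open IsLocalRing

variable {R : Type u} [CommRing R] [IsLocalRing R]

/-- The homology `Tor₁(R/b, Z) = {z | b z = 0} / Ann(b) Z` is annihilated by the `k`-th power of
the maximal ideal, for every `b` outside the socle. -/
def IsTorsionBounded (R : Type u) [CommRing R] [IsLocalRing R] (k : ℕ) (Z : Type u)
    [AddCommGroup Z] [Module R Z] : Prop :=
  ∀ b : R, (∃ a ∈ maximalIdeal R, a * b ≠ 0) → ∀ z : Z, b • z = 0 →
    ∀ μ ∈ maximalIdeal R ^ k, μ • z ∈ (Ideal.span {b}).annihilator • (⊤ : Submodule R Z)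

theorem IsTorsionBounded.mono {k l : ℕ} (hkl : k ≤ l) {Z : Type u} [AddCommGroup Z] [Module R Z]
    (h : IsTorsionBounded R k Z) : IsTorsionBounded R l Z :=
  fun b hb z hz μ hμ => h b hb z hz μ (Ideal.pow_le_pow_right hkl hμ)

theorem exists_mul_ne_zero_and_mul_eq_zero {x b : R} (hx : IsNilpotent x)
    (hb : ∃ a ∈ maximalIdeal R, a * b ≠ 0) :
    ∃ c, (∃ a ∈ maximalIdeal R, a * (b * c) ≠ 0) ∧
      ∀ y ∈ maximalIdeal R, c * (y * x * b) = 0 := by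
  obtain ⟨n, hn⟩ := hx
  -- The witness c is the last power of x with bc outside the socle.
  by_contra! H
  have : ∀ j, ∃ a ∈ maximalIdeal R, a * (b * x ^ j) ≠ 0 := by
    intro j
    induction j with
    | zero => simpa using hb
    | succ j ih =>
      obtain ⟨y, hy, hy0⟩ := H (x ^ j) ih
      exact ⟨y, hy, by convert hy0 using 1; ring⟩
  obtain ⟨a, -, ha⟩ := this n
  simp [hn] at ha

/-- Lift z to f, with bf = z' in Z'. For x, y in m some c kills yxz' while bc is outside the socle,
so the bound on Z' puts νyxz' in Ann(c)Z'. A further factor w moves Ann(c) into (b), giving νwyxz' =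
bv; flatness of F applies to νwyxf - v. The factors x, y, w account for the 3. -/
theorem IsTorsionBounded.of_exact (h : IsAlmostChain R)
    (hnil : ∀ a ∈ maximalIdeal R, IsNilpotent a) {k : ℕ} {Z' F Z : Type u} [AddCommGroup Z']
    [Module R Z'] [AddCommGroup F] [Module R F] [AddCommGroup Z] [Module R Z] [Module.Flat R F]
    {i : Z' →ₗ[R] F} {p : F →ₗ[R] Z} (hi : Function.Injective i) (hip : Function.Exact i p)
    (hp : Function.Surjective p) (hZ' : IsTorsionBounded R k Z') :
    IsTorsionBounded R (k + 3) Z := by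
  intro b hb z hz
  obtain ⟨f, rfl⟩ := hp z
  obtain ⟨z', hz'⟩ := (hip (b • f)).mp (by rw [map_smul, hz])
  set W := (Ideal.span {b}).annihilator • (⊤ : Submodule R Z) with hW
  have key : ∀ x ∈ maximalIdeal R, ∀ y ∈ maximalIdeal R, ∀ w ∈ maximalIdeal R,
      ∀ ν ∈ maximalIdeal R ^ k, (ν * w * y * x) • p f ∈ W := by
    intro x hx y hy w hw ν hν
    obtain ⟨c, ⟨a₀, ha₀, hac⟩, hyc⟩ := exists_mul_ne_zero_and_mul_eq_zero (hnil x hx) hb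
    have hcz : c • ((y * x) • z') = 0 := by
      apply hi
      rw [map_smul, map_smul, hz', smul_smul, smul_smul, mul_assoc, hyc y hy, zero_smul, map_zero]
    have hmem := hZ' c ⟨a₀, ha₀, fun h0 => hac (by linear_combination b * h0)⟩ _ hcz ν hν
    obtain ⟨v, hv⟩ : ∃ v : Z', w • ν • (y * x) • z' = b • v := by
      refine Submodule.smul_induction_on (p := fun t => ∃ v : Z', w • t = b • v) hmem ?_ ?_
      · rintro r hr n -
        rw [Submodule.mem_annihilator_span_singleton] at hr
        obtain ⟨q, hq⟩ := h.dvd_mul_of_mul_eq_zero (hnil a₀ ha₀) (hnil w hw) hac hr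
        exact ⟨q • n, by rw [smul_smul, smul_smul, ← hq, mul_comm]⟩
      · rintro s t ⟨v₁, h₁⟩ ⟨v₂, h₂⟩
        exact ⟨v₁ + v₂, by rw [smul_add, smul_add, h₁, h₂]⟩
    have hzero : b • ((ν * w * y * x) • f - i v) = 0 := by
      rw [smul_sub, ← map_smul, ← hv]
      simp only [map_smul, hz', smul_smul]
      rw [← sub_smul]
      convert zero_smul R f using 2
      ring
    have := Submodule.mem_map_of_mem (f := p) (Module.Flat.mem_annihilator_smul_top hzero)
    rw [Submodule.map_smul'', map_sub, (hip (i v)).mpr ⟨v, rfl⟩, sub_zero, map_smul] at this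
    exact Submodule.smul_mono le_rfl le_top this
  intro μ hμ
  rw [pow_succ, pow_succ, pow_succ] at hμ
  refine Submodule.mul_induction_on hμ (fun r hr x hx => ?_)
    fun r s hr hs => by rw [add_smul]; exact add_mem hr hs
  refine Submodule.mul_induction_on hr (fun r hr y hy => ?_)
    fun r s hr hs => by rw [add_mul, add_smul]; exact add_mem hr hs
  refine Submodule.mul_induction_on hr (fun ν hν w hw => key x hx y hy w hw ν hν)
    fun r s hr hs => by rw [add_mul, add_mul, add_smul]; exact add_mem hr hs

theorem HasFlatDimLE.isTorsionBounded (h : IsAlmostChain R)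
    (hnil : ∀ a ∈ maximalIdeal R, IsNilpotent a) {n : ℕ} {Z : Type u} [AddCommGroup Z]
    [Module R Z] (hZ : HasFlatDimLE R n Z) : IsTorsionBounded R (3 * n) Z := by
  induction n generalizing Z with
  | zero =>
    intro b _ z hz μ _
    have : Module.Flat R Z := hZ
    exact Submodule.smul_mem _ _ (Module.Flat.mem_annihilator_smul_top hz)
  | succ n ih =>
    obtain ⟨Z', F, i, p, hi, hip, hp, hF, hZ'⟩ := hZ
    exact (ih hZ').of_exact h hnil hi hip hp

theorem IsTorsionBounded.exists_eq_add {k : ℕ} {b : R} (hbm : b ∈ maximalIdeal R)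
    (hb : b ^ 2 ≠ 0) (h : IsTorsionBounded R k (R ⧸ Ideal.span {b})) {μ : R}
    (hμ : μ ∈ maximalIdeal R ^ k) : ∃ r u, μ = r + u * b ∧ r * b = 0 :=
  exists_eq_add_of_smul_mk_one_mem
    (h b ⟨b, hbm, by rwa [← sq]⟩ _ (smul_mk_span_singleton_one b) μ hμ)

theorem IsAlmostChain.isNilpotent_maximalIdeal (h : IsAlmostChain R)
    (hnil : ∀ a ∈ maximalIdeal R, IsNilpotent a) {N : ℕ}
    (hN : ∀ (M : Type u) [AddCommGroup M] [Module R M], ∃ n ≤ N, HasFlatDimLE R n M) :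
    ∃ k, maximalIdeal R ^ k = ⊥ := by
  -- The exponent 3N suffices for the torsion bound; the extra 1 ensures b ∈ m when N = 0.
  by_cases H : ∀ b ∈ maximalIdeal R ^ (3 * N + 1), (b ^ 2) ^ 2 = 0
  · exact ⟨(3 * N + 1) * 4, by rw [pow_mul]; exact h.pow_four_eq_bot H⟩
  push Not at H
  obtain ⟨b, hb, hb4⟩ := H
  have hbm : b ∈ maximalIdeal R := Ideal.pow_le_self (by omega) hb
  obtain ⟨n, hn, hdim⟩ := hN (R ⧸ Ideal.span {b ^ 2})
  obtain ⟨r, u, hru, hr⟩ := ((hdim.isTorsionBounded h hnil).mono (by omega)).exists_eq_add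
    (Ideal.pow_mem_of_mem _ hbm 2 two_pos) hb4 hb
  have hr2 := (h.sq_eq_zero_or hr).resolve_right hb4
  -- From b = r + ub², the element b is a unit multiple of r, whose square is zero.
  have hnub : IsNilpotent (u * b) := (Commute.all u b).isNilpotent_mul_left (hnil b hbm)
  obtain ⟨w, hw⟩ := hnub.isUnit_one_sub.dvd (a := (1 : R))
  have hbr : b = w * r := by linear_combination b * hw + w * hru
  have hb2 : b ^ 2 = 0 := hbr ▸ sq_mul_eq_zero w hr2
  exact absurd (by rw [hb2]; simp) hb4

end NonNilpotent

end BazzoniGlaz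

/-! ### Purity, and collapse of flat dimension when m is nilpotent -/

namespace BazzoniGlaz

open TensorProduct

section Purity

variable {R : Type u} [CommRing R] {Z' F : Type u} [AddCommGroup Z'] [Module R Z']
  [AddCommGroup F] [Module R F] {i : Z' →ₗ[R] F}

theorem lTensor_injective_of_exact [Module.Flat R F] {M₁ M M₂ : Type u}
    [AddCommGroup M₁] [Module R M₁] [AddCommGroup M] [Module R M] [AddCommGroup M₂] [Module R M₂]
    {f : M₁ →ₗ[R] M} {g : M →ₗ[R] M₂} (hf : Function.Injective f) (hfg : Function.Exact f g)
    (hg : Function.Surjective g) (h₁ : Function.Injective (i.lTensor M₁))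
    (h₂ : Function.Injective (i.lTensor M₂)) : Function.Injective (i.lTensor M) := by
  rw [injective_iff_map_eq_zero]
  intro u hu
  have hu2 : g.rTensor Z' u = 0 := by
    apply h₂
    rw [← LinearMap.comp_apply, LinearMap.lTensor_comp_rTensor, ← LinearMap.rTensor_comp_lTensor,
      LinearMap.comp_apply, hu, map_zero, map_zero]
  obtain ⟨v, rfl⟩ := (rTensor_exact Z' hfg hg u).mp hu2
  have : v = 0 := by
    apply h₁
    apply Module.Flat.rTensor_preserves_injective_linearMap (M := F) f hf
    rw [← LinearMap.comp_apply, LinearMap.lTensor_comp_rTensor,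
      ← LinearMap.rTensor_comp_lTensor] at hu
    rw [map_zero, map_zero]
    exact hu
  rw [this, map_zero]

/-- The hypothesis on `i` says Tor₁(M, Z) = 0 for all M. -/
theorem _root_.Module.Flat.of_exact_of_lTensor_injective [Module.Flat R F] {Z : Type u}
    [AddCommGroup Z] [Module R Z] {p : F →ₗ[R] Z}
    (hip : Function.Exact i p) (hp : Function.Surjective p)
    (h : ∀ (M : Type u) [AddCommGroup M] [Module R M], Function.Injective (i.lTensor M)) :
    Module.Flat R Z := by
  rw [Module.Flat.iff_rTensor_preserves_injective_linearMap]
  intro M N _ _ _ _ f hf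
  rw [injective_iff_map_eq_zero]
  intro u hu
  obtain ⟨v, rfl⟩ := LinearMap.lTensor_surjective M hp u
  have hv : p.lTensor N (f.rTensor F v) = 0 := by
    rw [← LinearMap.comp_apply, LinearMap.lTensor_comp_rTensor, ← LinearMap.rTensor_comp_lTensor]
    exact hu
  obtain ⟨w, hw⟩ := (lTensor_exact N hip hp _).mp hv
  let g := (LinearMap.range f).mkQ
  have hfg : Function.Exact f g := LinearMap.exact_map_mkQ_range f
  have hgs : Function.Surjective g := Submodule.mkQ_surjective _
  have hw0 : g.rTensor Z' w = 0 := by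
    apply h
    rw [← LinearMap.comp_apply, LinearMap.lTensor_comp_rTensor, ← LinearMap.rTensor_comp_lTensor,
      LinearMap.comp_apply, hw, map_zero]
    exact (rTensor_exact F hfg hgs _).mpr ⟨v, rfl⟩
  obtain ⟨t, rfl⟩ := (rTensor_exact Z' hfg hgs w).mp hw0
  have htv : i.lTensor M t = v := by
    apply Module.Flat.rTensor_preserves_injective_linearMap (M := F) f hf
    rw [← hw, ← LinearMap.comp_apply, ← LinearMap.comp_apply, LinearMap.lTensor_comp_rTensor,
      LinearMap.rTensor_comp_lTensor]
  rw [← htv]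
  exact (lTensor_exact M hip hp _).mpr ⟨t, rfl⟩

end Purity

section Nilpotent

open IsLocalRing

variable {R : Type u} [CommRing R] [IsLocalRing R]

/-- Over a local ring with nonzero socle, modules annihilated by the maximal ideal embed into free
modules. -/
theorem exists_injective_finsupp_of_smul_eq_zero {s : R} (hs : s ≠ 0)
    (hsm : ∀ a ∈ maximalIdeal R, a * s = 0) {M : Type u} [AddCommGroup M] [Module R M]
    (hM : ∀ a ∈ maximalIdeal R, ∀ x : M, a • x = 0) :
    ∃ (ι : Type u) (φ : M →ₗ[R] (ι →₀ R)), Function.Injective φ := by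
  let _ : Module (ResidueField R) M :=
    Module.IsTorsionBySet.module (I := maximalIdeal R) fun x a => hM a a.2 x
  have : IsScalarTower R (ResidueField R) M :=
    Module.IsTorsionBySet.isScalarTower (I := maximalIdeal R) fun x a => hM a a.2 x
  let b := Module.Basis.ofVectorSpace (ResidueField R) M
  let ψ : ResidueField R →ₗ[R] R := (maximalIdeal R).liftQ (LinearMap.toSpanSingleton R R s)
    fun a ha => by simpa using hsm a ha
  have hψ : Function.Injective ψ := by
    rw [injective_iff_map_eq_zero]
    intro x hx
    obtain ⟨r, rfl⟩ := residue_surjective x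
    have hrs : r * s = 0 := hx
    rw [residue_eq_zero_iff]
    by_contra hr
    have hu : IsUnit r := by simpa using hr
    exact hs (hu.mul_right_eq_zero.mp hrs)
  refine ⟨_, Finsupp.mapRange.linearMap ψ ∘ₗ b.repr.toLinearMap.restrictScalars R, ?_⟩
  exact (Finsupp.mapRange_injective ψ (map_zero _) hψ).comp b.repr.injective

variable {Z' F : Type u} [AddCommGroup Z'] [Module R Z'] [AddCommGroup F] [Module R F]
  {i : Z' →ₗ[R] F}

/-- Embed M in a free module L: flatness of Z' embeds M ⊗ Z' in L ⊗ Z', which embeds in L ⊗ F. -/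
theorem lTensor_injective_of_smul_eq_zero [Module.Flat R Z'] {s : R} (hs : s ≠ 0)
    (hsm : ∀ a ∈ maximalIdeal R, a * s = 0) (hi : Function.Injective i) {M : Type u}
    [AddCommGroup M] [Module R M] (hM : ∀ a ∈ maximalIdeal R, ∀ x : M, a • x = 0) :
    Function.Injective (i.lTensor M) := by
  obtain ⟨ι, φ, hφ⟩ := exists_injective_finsupp_of_smul_eq_zero hs hsm hM
  have h1 := Module.Flat.rTensor_preserves_injective_linearMap (M := Z') φ hφ
  have h2 := Module.Flat.lTensor_preserves_injective_linearMap (M := ι →₀ R) i hi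
  refine Function.Injective.of_comp (f := φ.rTensor F) ?_
  rw [← LinearMap.coe_comp, LinearMap.rTensor_comp_lTensor, ← LinearMap.lTensor_comp_rTensor]
  exact h2.comp h1

theorem lTensor_injective_of_pow_smul_eq_zero [Module.Flat R Z'] [Module.Flat R F]
    {s : R} (hs : s ≠ 0)
    (hsm : ∀ a ∈ maximalIdeal R, a * s = 0) (hi : Function.Injective i) (k : ℕ) (M : Type u)
    [AddCommGroup M] [Module R M] (hM : ∀ a ∈ maximalIdeal R ^ k, ∀ x : M, a • x = 0) :
    Function.Injective (i.lTensor M) := by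
  induction k generalizing M with
  | zero =>
    have : Subsingleton M := ⟨fun x y => by
      rw [← one_smul R x, ← one_smul R y, hM 1 (by simp), hM 1 (by simp)]⟩
    exact Function.injective_of_subsingleton _
  | succ k ih =>
    let P := maximalIdeal R • (⊤ : Submodule R M)
    refine lTensor_injective_of_exact (f := P.subtype) (g := P.mkQ) P.subtype_injective
      (LinearMap.exact_subtype_mkQ P) P.mkQ_surjective (ih P ?_)
      (lTensor_injective_of_smul_eq_zero hs hsm hi ?_)
    · rintro a ha ⟨x, hx⟩
      ext
      refine Submodule.smul_induction_on (p := fun x => a • x = 0) hx ?_ ?_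
      · intro r hr n _
        rw [smul_smul]
        exact hM _ (by rw [pow_succ]; exact Ideal.mul_mem_mul ha hr) n
      · intro x y hx hy
        rw [smul_add, hx, hy, add_zero]
    · intro a ha x
      obtain ⟨x, rfl⟩ := P.mkQ_surjective x
      rw [← map_smul, Submodule.mkQ_apply, Submodule.Quotient.mk_eq_zero]
      exact Submodule.smul_mem_smul ha trivial

theorem exists_socle_of_pow_eq_bot {k : ℕ} (hk : maximalIdeal R ^ k = ⊥)
    (h0 : maximalIdeal R ≠ ⊥) :
    ∃ s ∈ maximalIdeal R, s ≠ 0 ∧ ∀ a ∈ maximalIdeal R, a * s = 0 := by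
  induction k with
  | zero => simp at hk
  | succ k ih =>
    by_cases hk' : maximalIdeal R ^ k = ⊥
    · exact ih hk'
    have hk0 : k ≠ 0 := by
      rintro rfl
      exact h0 (by simpa using hk)
    obtain ⟨s, hs, hs0⟩ := Submodule.exists_mem_ne_zero_of_ne_bot hk'
    refine ⟨s, Ideal.pow_le_self hk0 hs, hs0, fun a ha => ?_⟩
    have : s * a ∈ maximalIdeal R ^ (k + 1) := by
      rw [pow_succ]; exact Ideal.mul_mem_mul hs ha
    rw [hk] at this
    rw [mul_comm]
    exact this

/-- A flat submodule of a flat module is pure here, by dévissage along powers of m, so its quotient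
is flat. -/
theorem HasFlatDimLE.flat_of_pow_eq_bot {k : ℕ} (hk : maximalIdeal R ^ k = ⊥) {s : R}
    (hs : s ≠ 0) (hsm : ∀ a ∈ maximalIdeal R, a * s = 0) {n : ℕ} {M : Type u} [AddCommGroup M]
    [Module R M] (hM : HasFlatDimLE R n M) : Module.Flat R M := by
  induction n generalizing M with
  | zero => exact hM
  | succ n ih =>
    obtain ⟨Z', F, i, p, hi, hip, hp, hF, hZ'⟩ := hM
    have := ih hZ'
    refine Module.Flat.of_exact_of_lTensor_injective hip hp fun N _ _ =>
      lTensor_injective_of_pow_smul_eq_zero hs hsm hi k N fun a ha x => ?_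
    rw [hk, Ideal.mem_bot] at ha
    rw [ha, zero_smul]

theorem maximalIdeal_eq_bot_of_pow_eq_bot {k : ℕ} (hk : maximalIdeal R ^ k = ⊥)
    (h : ∀ (M : Type u) [AddCommGroup M] [Module R M], ∃ n, HasFlatDimLE R n M) :
    maximalIdeal R = ⊥ := by
  by_contra h0
  obtain ⟨s, hs, hs0, hsm⟩ := exists_socle_of_pow_eq_bot hk h0
  obtain ⟨n, hn⟩ := h (R ⧸ Ideal.span {s})
  have := hn.flat_of_pow_eq_bot hk hs0 hsm
  have hmem := Module.Flat.mem_annihilator_smul_top (smul_mk_span_singleton_one s)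
  rw [← one_smul R (Ideal.Quotient.mk (Ideal.span {s}) 1)] at hmem
  obtain ⟨r, u, hru, hr⟩ := exists_eq_add_of_smul_mk_one_mem hmem
  have hrm : r ∈ maximalIdeal R := by
    rw [mem_maximalIdeal, mem_nonunits_iff]
    exact fun hu => hs0 (hu.mul_right_eq_zero.mp hr)
  -- Flatness of R/s would give 1 ∈ Ann(s) + (s) ⊆ m.
  refine (Ideal.ne_top_iff_one _).mp (maximalIdeal.isMaximal R).ne_top ?_
  rw [hru]
  exact add_mem hrm (Ideal.mul_mem_left _ u hs)

end Nilpotent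

/-! ### Localization at the nilradical -/

section Localization

variable {R : Type u} [CommRing R]

theorem IsAlmostChain.isPrime_nilradical [Nontrivial R] (h : IsAlmostChain R) :
    (nilradical R).IsPrime where
  ne_top' := by
    rw [Ideal.ne_top_iff_one, mem_nilradical]
    exact not_isNilpotent_one
  mem_or_mem' := by
    intro x y hxy
    simp only [mem_nilradical] at hxy ⊢
    obtain ⟨n, hn⟩ := hxy
    rw [mul_pow] at hn
    exact (h.sq_eq_zero_or hn).imp (fun hx => ⟨n * 2, by rw [pow_mul, hx]⟩)
      fun hy => ⟨n * 2, by rw [pow_mul, hy]⟩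

theorem IsAlmostChain.of_isLocalization (h : IsAlmostChain R) (U : Submonoid R) (S : Type u)
    [CommRing S] [Algebra R S] [IsLocalization U S] : IsAlmostChain S := by
  have key : ∀ {a b s c : R} (x y : U), b = s * a + c → c * a = 0 → c ^ 2 = 0 →
      ∃ s' c' : S, IsLocalization.mk' S b y = s' * IsLocalization.mk' S a x + c' ∧
        c' * IsLocalization.mk' S a x = 0 ∧ c' ^ 2 = 0 := by
    intro a b s c x y hb hca hc
    refine ⟨IsLocalization.mk' S (s * x) y, IsLocalization.mk' S c y, ?_, ?_, ?_⟩
    · have e₁ := IsLocalization.mk'_spec S (s * x) y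
      have e₂ := IsLocalization.mk'_spec S a x
      have e₃ := IsLocalization.mk'_spec S c y
      rw [IsLocalization.mk'_eq_iff_eq_mul, hb, map_add, map_mul]
      rw [map_mul] at e₁
      linear_combination -IsLocalization.mk' S a x * e₁ - algebraMap R S s * e₂ - e₃
    · rw [← IsLocalization.mk'_mul, hca, IsLocalization.mk'_zero]
    · rw [← IsLocalization.mk'_pow, hc, IsLocalization.mk'_zero]
  intro a b
  obtain ⟨a, x, rfl⟩ := IsLocalization.exists_mk'_eq U a
  obtain ⟨b, y, rfl⟩ := IsLocalization.exists_mk'_eq U b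
  rcases h a b with ⟨s, c, hb, hca, hc⟩ | ⟨s, c, ha, hcb, hc⟩
  · exact .inl (key x y hb hca hc)
  · exact .inr (key y x ha hcb hc)

/-- An S-module M is S ⊗ M over R, and S is flat over R. -/
theorem exists_hasFlatDimLE_of_isLocalization (U : Submonoid R) (S : Type u)
    [CommRing S] [Algebra R S] [IsLocalization U S] {N : ℕ}
    (h : ∀ (M : Type u) [AddCommGroup M] [Module R M], ∃ n ≤ N, HasFlatDimLE R n M)
    (M : Type u) [AddCommGroup M] [Module S M] : ∃ n ≤ N, HasFlatDimLE S n M := by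
  let _ : Module R M := Module.compHom M (algebraMap R S)
  have : IsScalarTower R S M := .of_algebraMap_smul fun _ _ => rfl
  have : Module.Flat R S := IsLocalization.flat S U
  obtain ⟨n, hn, hM⟩ := h M
  exact ⟨n, hn, (hM.baseChange S).of_linearEquiv (IsLocalization.moduleLid U S M)⟩

end Localization

end BazzoniGlaz

/-! ### The theorem -/

open BazzoniGlaz in
theorem mainTheorem3 (R : Type u) [CommRing R] [IsLocalRing R]
    (hGaussian : BazzoniGlaz.IsGaussianRing R)
    (hNonReduced : ¬ IsReduced R)
    (hD : (nilradical R : Set R) ≠ {x : R | x ^ 2 = 0}) :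
    BazzoniGlaz.weakGlobalDim R = ⊤ := by
  by_contra hfin
  obtain ⟨N, hN⟩ := exists_forall_hasFlatDimLE hfin
  have h := hGaussian.isAlmostChain
  have := h.isPrime_nilradical
  let S := Localization.AtPrime (nilradical R)
  have hS : IsAlmostChain S := h.of_isLocalization (nilradical R).primeCompl S
  have hdim := exists_hasFlatDimLE_of_isLocalization (nilradical R).primeCompl S hN
  have hnil : ∀ a ∈ IsLocalRing.maximalIdeal S, IsNilpotent a := by
    intro a ha
    obtain ⟨r, s, rfl⟩ := IsLocalization.exists_mk'_eq (nilradical R).primeCompl a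
    obtain ⟨n, hn⟩ := (IsLocalization.AtPrime.mk'_mem_maximal_iff S (nilradical R) r s).mp ha
    exact ⟨n, by rw [← IsLocalization.mk'_pow, hn, IsLocalization.mk'_zero]⟩
  obtain ⟨k, hk⟩ := hS.isNilpotent_maximalIdeal hnil hdim
  have hbot := maximalIdeal_eq_bot_of_pow_eq_bot hk fun M _ _ =>
    (hdim M).imp fun _ => And.right
  refine hD (Set.ext fun x => ⟨fun hx => ?_, fun hx => ⟨2, hx⟩⟩)
  have hx' := (IsLocalization.AtPrime.to_map_mem_maximal_iff S (nilradical R) x).mpr hx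
  -- As x vanishes in S, some non-nilpotent s kills it; since s² ≠ 0, x² = 0.
  rw [hbot, Ideal.mem_bot, IsLocalization.map_eq_zero_iff (nilradical R).primeCompl] at hx'
  obtain ⟨⟨s, hs⟩, hsx⟩ := hx'
  exact (h.sq_eq_zero_or hsx).resolve_left fun h2 => hs ⟨2, h2⟩
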